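/- All groups are abelian and written additively. A valuation on a group $H$ is a map $v:H\to\Gamma\cup\{\infty\}$, with $\Gamma$ totally ordered and $\gamma<\infty$ for all $\gamma\in\Gamma$, such that $v(g)=\infty\Leftrightarrow g=0$, $v(g+h)\ge\min(v(g),v(h))$ and $v(-g)=v(g)$. It induces the quasi-order $a\precsim b:\Leftrightarrow v(b)\le v(a)$; quasi-orders of this form are called valuational. For a quasi-order $\precsim$ write $a\sim b$ for $a\precsim b\precsim a$, and $a\precnsim b$ for $a\precsim b\wedge a\not\sim b$. For an ordered group $(G,\le)$ and a group $H$ with a valuational quasi-order $\precsim_H$, the compatible product $G\times_c H$ is the group $G\times H$ with the quasi-order $$(g,h)\precsim(g',h')\iff (h=h'=0\wedge g\le g')\ \vee\ (h'\ne 0\wedge h\precsim_H h').$$ In a group with a quasi-order $\precsim$, an element $g$ is o-type if its $\sim$-class is $\{g\}$ and its order is not $2$; $X^o$ denotes the set of o-type elements of the group $X$ and $X^v$ its complement. The induced C-relation on $X$ is $$C(x,y,z)\iff (x\ne y=z)\vee(x-z\in X^v\wedge y-z\precnsim x-z)\vee(y-z,\,x-z\in X^o\wedge 0\precnsim x-y\wedge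 0\precnsim x-z).$$ A C-relation is a ternary relation $C$ with: $C(x,y,z)\Rightarrow C(x,z,y)$; $C(x,y,z)\Rightarrow\neg C(y,x,z)$; $C(x,y,z)\Rightarrow C(w,y,z)\vee C(x,w,z)$; $x\neq y\Rightarrow C(x,y,y)$. A C-minimal group is a group $X$ with a C-relation $C$ that is invariant under translations, such that in every structure $N$ elementarily equivalent to $(X,0,+,-,C)$ every subset of $N$ definable with parameters is definable by a quantifier-free formula, with parameters, of the language $\{C\}$. An ordered group $(G,\leq)$ is o-minimal if every subset of $G$ definable with parameters in $(G,0,+,-,\le)$ is a finite disjoint union of intervals with endpoints in $G\cup\{\pm\infty\}$ (points included). **Theorem.** Let $G$ be an o-minimal ordered group and $H$ a finite group with a valuational quasi-order. Then $G\times_c H$, with its induced C-relation, is a C-minimal group. In particular, for every prime $p$ and $k\ge 0$, the group $\mathbb{Q}\times_c\mathbb{Z}/p^k\mathbb{Z}$ is C-minimal, where $\mathbb{Q}$ has its usual order and $\mathbb{Z}/p^k\mathbb{Z}$ the quasi-order of the valuation induced by the $p$-adic valuation of $\mathbb{Z}$. If $k\ge1$, its quasi-order is neither an order (it is not antisymmetric)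 nor valuational, and its C-relation is neither the one induced by a group order, $(y<x\wedge z<x)\vee(y=z\ne x)$, nor the one induced by a valuation, $v(y-z)>v(x-z)$. -/

import Mathlib

open FirstOrder

/-! ## Valuations and quasi-orders on abelian groups -/

/-- A valuation `v : G → Γ ∪ {∞}` on an abelian group `G`, where `Γ` is a totally ordered set. -/
structure GroupValuation (G : Type*) [AddCommGroup G] (Γ : Type*) [LinearOrder Γ] where
  toFun : G → WithTop Γ
  eq_top_iff : ∀ g, toFun g = ⊤ ↔ g = 0
  min_le_add : ∀ g h, min (toFun g) (toFun h) ≤ toFun (g + h)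
  map_neg : ∀ g, toFun (-g) = toFun g

/-- The quasi-order induced by a valuation: `a ≾ b` iff `v b ≤ v a`. -/
def GroupValuation.qo {G : Type*} [AddCommGroup G] {Γ : Type*} [LinearOrder Γ]
    (v : GroupValuation G Γ) (a b : G) : Prop :=
  v.toFun b ≤ v.toFun a

universe u v w t

/-- A quasi-order is valuational if it is induced by a valuation. -/
def IsValuational {G : Type u} [AddCommGroup G] (r : G → G → Prop) : Prop :=
  ∃ (Γ : Type w) (_ : LinearOrder Γ) (v : GroupValuation G Γ), ∀ a b, r a b ↔ v.qo a b

/-- The strict part `a ⋨ b` of a quasi-order: `a ≾ b` and not `a ∼ b`. -/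
def StrictQO {G : Type*} (r : G → G → Prop) (a b : G) : Prop :=
  r a b ∧ ¬ (r a b ∧ r b a)

/-- `g` is o-type: its `∼`-class is `{g}` and its order is not `2`. -/
def IsOType {G : Type*} [AddCommGroup G] (r : G → G → Prop) (g : G) : Prop :=
  {h | r h g ∧ r g h} = {g} ∧ addOrderOf g ≠ 2

/-- The compatible product of an ordered group `(G, ≤)` and a group `(H, ≾)` with a valuational
quasi-order.  The underlying group is `G × H`; its ordered part is `G × {0}`, ordered as `G`,
and the quotient by the ordered part is `H`, with its own quasi-order. -/
def compatibleProduct {G H : Type*} [AddCommGroup G] [LinearOrder G] [AddCommGroup H]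
    (r : H → H → Prop) (x y : G × H) : Prop :=
  (x.2 = 0 ∧ y.2 = 0 ∧ x.1 ≤ y.1) ∨ (y.2 ≠ 0 ∧ r x.2 y.2)

/-! ## C-relations -/

/-- The axioms of C-relations. -/
structure IsCRelation {M : Type*} (C : M → M → M → Prop) : Prop where
  c1 : ∀ x y z, C x y z → C x z y
  c2 : ∀ x y z, C x y z → ¬ C y x z
  c3 : ∀ x y z w, C x y z → C w y z ∨ C x w z
  c4 : ∀ x y, x ≠ y → C x y y

/-- A C-relation on an abelian group compatible with `+`. -/
structure IsCompatibleCRelation {G : Type*} [AddCommGroup G] (C : G → G → G → Prop) : Prop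
    extends IsCRelation C where
  translate : ∀ x y z u v, C x y z → C (v + x + u) (v + y + u) (v + z + u)

/-- The C-relation induced by a (compatible) quasi-order. Elements that are not o-type form the
set `G^v`. -/
def inducedC {G : Type*} [AddCommGroup G] (r : G → G → Prop) (x y z : G) : Prop :=
  (x ≠ y ∧ y = z) ∨
  (¬ IsOType r (x - z) ∧ StrictQO r (y - z) (x - z)) ∨
  (IsOType r (y - z) ∧ IsOType r (x - z) ∧ StrictQO r 0 (x - y) ∧ StrictQO r 0 (x - z))

/-- `C` is the C-relation of an ordered abelian group structure on `G`. -/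
def IsInducedByGroupOrder {G : Type*} [AddCommGroup G] (C : G → G → G → Prop) : Prop :=
  ∃ _ : LinearOrder G, IsOrderedAddMonoid G ∧
    ∀ x y z, C x y z ↔ (y < x ∧ z < x) ∨ (y = z ∧ z ≠ x)

/-- `C` is the C-relation of a valuation on `G`. -/
def IsInducedByValuation {G : Type u} [AddCommGroup G] (C : G → G → G → Prop) : Prop :=
  ∃ (Γ : Type w) (_ : LinearOrder Γ) (v : GroupValuation G Γ),
    ∀ x y z, C x y z ↔ v.toFun (x - z) < v.toFun (y - z)

/-! ## Languages and structures -/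

/-- The function symbols `0`, `-`, `+`. -/
inductive GroupFunc : ℕ → Type
  | zero : GroupFunc 0
  | neg : GroupFunc 1
  | add : GroupFunc 2

/-- The relation symbol `≾`. -/
inductive QORel : ℕ → Type
  | le : QORel 2

/-- The relation symbol `C`. -/
inductive CRel : ℕ → Type
  | c : CRel 3

/-- The language `{0, +, -, ≾}`. -/
abbrev qoGroupLanguage : Language := ⟨GroupFunc, QORel⟩

/-- The language `{0, +, -, C}`. -/
abbrev cGroupLanguage : Language := ⟨GroupFunc, CRel⟩

/-- The language `{C}`. -/
abbrev cLanguage : Language := ⟨fun _ => Empty, CRel⟩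

/-- The inclusion of `{C}` in `{0, +, -, C}`. -/
@[reducible] def cInclusion : cLanguage →ᴸ cGroupLanguage where
  onFunction := fun _ f => Empty.elim f
  onRelation := fun _ R => R

/-- The interpretation of `0`, `-`, `+` in an abelian group. -/
def groupFunMap {G : Type*} [AddCommGroup G] : ∀ {n}, GroupFunc n → (Fin n → G) → G
  | _, .zero, _ => 0
  | _, .neg, a => - a 0
  | _, .add, a => a 0 + a 1

/-- A group with a binary relation as a `{0, +, -, ≾}`-structure. -/
@[reducible] def qoGroupStructure {G : Type*} [AddCommGroup G] (r : G → G → Prop) :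
    qoGroupLanguage.Structure G where
  funMap := fun f a => groupFunMap f a
  RelMap := fun R a => match R, a with
    | QORel.le, a => r (a 0) (a 1)

/-- A group with a ternary relation as a `{0, +, -, C}`-structure. -/
@[reducible] def cGroupStructure {G : Type*} [AddCommGroup G] (C : G → G → G → Prop) :
    cGroupLanguage.Structure G where
  funMap := fun f a => groupFunMap f a
  RelMap := fun R a => match R, a with
    | CRel.c, a => C (a 0) (a 1) (a 2)

/-! ## Minimality -/

/-- An interval, with endpoints in `G ∪ {±∞}`. -/
def IsIntervalSet {G : Type*} [LinearOrder G] (I : Set G) : Prop :=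
  I = Set.univ ∨
  (∃ a, I = Set.Iio a ∨ I = Set.Iic a ∨ I = Set.Ioi a ∨ I = Set.Ici a) ∨
  (∃ a b, I = Set.Ioo a b ∨ I = Set.Ioc a b ∨ I = Set.Ico a b ∨ I = Set.Icc a b)

/-- An ordered group is o-minimal if every subset that is definable (with parameters, in the
language `{0, +, -, ≤}`) is a finite disjoint union of intervals. -/
def IsOMinimalGroup (G : Type*) [AddCommGroup G] [LinearOrder G] : Prop :=
  letI := qoGroupStructure (fun a b : G => a ≤ b)
  ∀ S : Set G, (Set.univ : Set G).Definable₁ qoGroupLanguage S →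
    ∃ F : Set (Set G), F.Finite ∧ (∀ I ∈ F, IsIntervalSet I) ∧ F.PairwiseDisjoint id ∧ S = ⋃₀ F

/-- Let `L` be a language containing the symbol `C` (through `ι`). A subset `S` of an
`L`-structure is quantifier-free definable, with parameters, in the language `{C}`, that is, in
the reduct of the structure to `{C}`. -/
def IsCQuantifierFreeDefinable {L : FirstOrder.Language.{0, 0}} (ι : cLanguage →ᴸ L) {N : Type*}
    [L.Structure N] (S : Set N) : Prop :=
  letI : cLanguage.Structure N := ι.reduct N
  ∃ ψ : cLanguage.Formula (N ⊕ Unit), ψ.IsQF ∧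
    ∀ x : N, x ∈ S ↔ ψ.Realize (Sum.elim id (fun _ => x))

/-- An `L`-structure, where `L` contains the symbol `C` (through `ι`), is C-minimal if `C` is
interpreted by a C-relation and in every elementarily equivalent structure all definable subsets
are quantifier-free definable in `{C}`. -/
def IsCMinimal {L : FirstOrder.Language.{0, 0}} (ι : cLanguage →ᴸ L) (M : Type u) [L.Structure M] : Prop :=
  IsCRelation (fun x y z : M => Language.Structure.RelMap (ι.onRelation CRel.c) ![x, y, z]) ∧
  ∀ (N : Type w) [L.Structure N], L.ElementarilyEquivalent M N →
    ∀ S : Set N, (Set.univ : Set N).Definable₁ L S → IsCQuantifierFreeDefinable ι S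

/-- `(G, C)` is a C-minimal group: `C` is a C-relation compatible with `+`, and the structure
`(G, 0, +, -, C)` is C-minimal. -/
def IsCMinimalGroup {G : Type u} [AddCommGroup G] (C : G → G → G → Prop) : Prop :=
  IsCompatibleCRelation C ∧
  letI := cGroupStructure C
  IsCMinimal.{u, w} cInclusion G

/-! ## The `p`-adic valuation of `ℤ/p^kℤ` -/

/-- The valuation of `ℤ/p^kℤ` induced by the `p`-adic valuation of `ℤ`: a nonzero class is sent
to the `p`-adic valuation of any of its representatives, and `0` is sent to `∞`. -/
def zmodPadicValuation (p k : ℕ) [Fact p.Prime] : GroupValuation (ZMod (p ^ k)) ℕ where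
  toFun x := if x = 0 then ⊤ else (padicValNat p x.val : WithTop ℕ)
  eq_top_iff g := by
    by_cases h : g = 0 <;> simp [h]
  min_le_add g h := by
    have : NeZero (p ^ k) := ⟨pow_ne_zero _ (Fact.out : p.Prime).ne_zero⟩
    by_cases hg : g = 0
    · simp [hg]
    by_cases hh : h = 0
    · simp [hh]
    by_cases hs : g + h = 0
    · simp [hs]
    have key : ∀ m, p ^ m ∣ g.val → p ^ m ∣ h.val → m ≤ padicValNat p (g + h).val := by
      intro m h1 h2
      have hg0 : g.val ≠ 0 := by rwa [Ne, ZMod.val_eq_zero]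
      have hmk : m ≤ k := by
        have := (Nat.le_of_dvd (Nat.pos_of_ne_zero hg0) h1).trans_lt (ZMod.val_lt g)
        exact ((Nat.pow_lt_pow_iff_right (Fact.out : p.Prime).one_lt).1 this).le
      rw [← padicValNat_dvd_iff_le (by rwa [Ne, ZMod.val_eq_zero]), ZMod.val_add]
      exact (Nat.dvd_mod_iff (pow_dvd_pow p hmk)).2 (dvd_add h1 h2)
    simp only [hg, hh, hs, if_false]
    rcases le_total (padicValNat p g.val) (padicValNat p h.val) with hle | hle
    · refine (min_le_left _ _).trans (WithTop.coe_le_coe.2 (key _ pow_padicValNat_dvd ?_))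
      exact (pow_dvd_pow p hle).trans pow_padicValNat_dvd
    · refine (min_le_right _ _).trans (WithTop.coe_le_coe.2 (key _ ?_ pow_padicValNat_dvd))
      exact (pow_dvd_pow p hle).trans pow_padicValNat_dvd
  map_neg g := by
    have : NeZero (p ^ k) := ⟨pow_ne_zero _ (Fact.out : p.Prime).ne_zero⟩
    have key : ∀ a : ZMod (p ^ k), a ≠ 0 → padicValNat p a.val ≤ padicValNat p (-a).val := by
      intro a ha
      have ha0 : a.val ≠ 0 := by rwa [Ne, ZMod.val_eq_zero]
      have hmk : padicValNat p a.val ≤ k := by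
        have := (Nat.le_of_dvd (Nat.pos_of_ne_zero ha0) (pow_padicValNat_dvd (p := p))).trans_lt
          (ZMod.val_lt a)
        exact ((Nat.pow_lt_pow_iff_right (Fact.out : p.Prime).one_lt).1 this).le
      rw [← padicValNat_dvd_iff_le (by rwa [Ne, ZMod.val_eq_zero, neg_eq_zero]), ZMod.neg_val,
        if_neg ha]
      exact Nat.dvd_sub (pow_dvd_pow p hmk) pow_padicValNat_dvd
    by_cases hg : g = 0
    · simp [hg]
    have h2 := key (-g) (by simpa using hg)
    rw [neg_neg] at h2
    simp only [hg, neg_eq_zero, if_false]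
    rw [le_antisymm h2 (key g hg)]

/-! An o-minimal ordered group is divisible (`IsOMinimalGroup.divisible`), and only divisibility is
used afterwards. Since `H` is finite, a quantifier over `G × H` is a finite conjunction or
disjunction of quantifiers over `G`. Once the `H`-components of all variables are fixed, the atomic
formulas become linear conditions on the `G`-components (`inducedC_compatibleProduct_iff`).
Quantifier elimination for divisible ordered groups (`IsSemilinear.projection`) then shows that
every formula defines semilinear sets (`isSemilinear_setOf_realize`). In one variable, a semilinear
set is a Boolean combination of rays, so it remains to cut out each fibre over `H`, and each ray in
a fibre, by quantifier-free `C`-formulas (`isUniformlyQF_fiber`, `isUniformlyQF_ray`). An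
elementarily equivalent structure need not be a product. Therefore the argument yields, for each
formula, finitely many quantifier-free formulas serving all parameters; this is a first-order
sentence and transfers (`isCMinimal_of_isUniformlyQF`). -/

/-! ## Semilinear sets over an ordered abelian group -/

/-- Affine maps `G ^ V → G` with rational coefficients. -/
inductive IsAffineMap {G : Type*} [AddCommGroup G] {V : Type*} : ((V → G) → G) → Prop
  | const (a : G) : IsAffineMap fun _ => a
  | coord (i : V) : IsAffineMap fun g => g i
  | add {f₁ f₂ : (V → G) → G} :
      IsAffineMap f₁ → IsAffineMap f₂ → IsAffineMap fun g => f₁ g + f₂ g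
  | neg {f : (V → G) → G} : IsAffineMap f → IsAffineMap fun g => -f g
  -- This gives rational coefficients without a `ℚ`-module structure; when `G` is ordered, hence
  -- torsion-free, `f` is determined by `n • f`.
  | div {f : (V → G) → G} (n : ℕ) : n ≠ 0 → (IsAffineMap fun g => n • f g) → IsAffineMap f

/-- Semilinear sets: Boolean combinations of open half-spaces. -/
inductive IsSemilinear {G : Type*} [AddCommGroup G] [LinearOrder G] {V : Type*} :
    Set (V → G) → Prop
  | pos {f : (V → G) → G} : IsAffineMap f → IsSemilinear {g | 0 < f g}
  | compl {S : Set (V → G)} : IsSemilinear S → IsSemilinear Sᶜ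
  | inter {S T : Set (V → G)} : IsSemilinear S → IsSemilinear T → IsSemilinear (S ∩ T)

/-- The point of `G ^ (Option V)` with coordinates `x` and `g`. -/
def optionCons {G : Type*} {V : Type*} (x : G) (g : V → G) (o : Option V) : G := o.elim x g

namespace IsAffineMap

variable {G : Type*} [AddCommGroup G] {V W : Type*}

theorem sub {f₁ f₂ : (V → G) → G} (h₁ : IsAffineMap f₁) (h₂ : IsAffineMap f₂) :
    IsAffineMap fun g => f₁ g - f₂ g := by
  simpa only [sub_eq_add_neg] using h₁.add h₂.neg

theorem comp {f : (V → G) → G} (hf : IsAffineMap f) {F : (W → G) → V → G}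
    (hF : ∀ i, IsAffineMap fun h => F h i) : IsAffineMap fun h => f (F h) := by
  induction hf with
  | const a => exact .const a
  | coord i => exact hF i
  | add _ _ h₁ h₂ => exact h₁.add h₂
  | neg _ h => exact h.neg
  | div n hn _ h => exact .div n hn h

/-- Clearing denominators isolates an integer coefficient for the distinguished variable `none`. -/
theorem exists_normal_form {f : (Option V → G) → G} (hf : IsAffineMap f) :
    ∃ (N : ℕ) (n : ℤ) (l : (V → G) → G), N ≠ 0 ∧ IsAffineMap l ∧
      ∀ x g, N • f (optionCons x g) = n • x + l g := by
  induction hf with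
  | const a => exact ⟨1, 0, fun _ => a, one_ne_zero, .const a, by simp⟩
  | coord i =>
    cases i with
    | none => exact ⟨1, 1, fun _ => 0, one_ne_zero, .const 0, by simp [optionCons]⟩
    | some i => exact ⟨1, 0, fun g => g i, one_ne_zero, .coord i, by simp [optionCons]⟩
  | add _ _ h₁ h₂ =>
    obtain ⟨N₁, n₁, l₁, hN₁, hl₁, e₁⟩ := h₁
    obtain ⟨N₂, n₂, l₂, hN₂, hl₂, e₂⟩ := h₂
    have smul : ∀ (n : ℕ) {l : (V → G) → G}, IsAffineMap l → IsAffineMap fun g => n • l g := by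
      intro n l hl
      induction n with
      | zero => simpa using IsAffineMap.const (0 : G)
      | succ n ih => simpa only [succ_nsmul] using ih.add hl
    refine ⟨N₁ * N₂, N₂ * n₁ + N₁ * n₂, fun g => N₂ • l₁ g + N₁ • l₂ g,
      mul_ne_zero hN₁ hN₂, (smul _ hl₁).add (smul _ hl₂), fun x g => ?_⟩
    rw [smul_add, mul_comm N₁ N₂, mul_smul, e₁, mul_comm N₂ N₁, mul_smul, e₂]
    simp only [smul_add, add_smul, mul_smul, natCast_zsmul]
    abel
  | neg _ h =>
    obtain ⟨N, n, l, hN, hl, e⟩ := h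
    refine ⟨N, -n, fun g => -l g, hN, hl.neg, fun x g => ?_⟩
    rw [smul_neg, e, neg_smul, neg_add]
  | div m hm _ h =>
    obtain ⟨N, n, l, hN, hl, e⟩ := h
    exact ⟨N * m, n, l, mul_ne_zero hN hm, hl, fun x g => by rw [mul_smul, e]⟩

/-- The three cases are the sign of the coefficient of `x`. When it is nonzero, divisibility allows
solving for `x`, and the resulting threshold is affine by `div`. -/
theorem pos_iff_lt [LinearOrder G] [IsOrderedAddMonoid G]
    (hdiv : ∀ n : ℕ, n ≠ 0 → ∀ x : G, ∃ y, n • y = x)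
    {f : (Option V → G) → G} (hf : IsAffineMap f) :
    ∃ c : (V → G) → G, IsAffineMap c ∧
      ((∀ x g, 0 < f (optionCons x g) ↔ 0 < c g) ∨
       (∀ x g, 0 < f (optionCons x g) ↔ c g < x) ∨
       (∀ x g, 0 < f (optionCons x g) ↔ x < c g)) := by
  obtain ⟨N, n, l, hN, hl, e⟩ := hf.exists_normal_form
  have hpos : ∀ x g, 0 < f (optionCons x g) ↔ 0 < n • x + l g := fun x g => by
    rw [← e, nsmul_pos_iff hN]
  obtain ⟨m, rfl | rfl⟩ := n.eq_nat_or_neg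
  · by_cases hm : m = 0
    · exact ⟨l, hl, .inl fun x g => by simp [hpos, hm]⟩
    choose d hd using hdiv m hm
    refine ⟨fun g => d (-l g), .div m hm (by simpa only [hd] using hl.neg), .inr (.inl fun x g => ?_)⟩
    rw [hpos, ← sub_pos (b := d (-l g)), ← nsmul_pos_iff hm (x := x - _), nsmul_sub, hd,
      sub_neg_eq_add, natCast_zsmul]
  · by_cases hm : m = 0
    · exact ⟨l, hl, .inl fun x g => by simp [hpos, hm]⟩
    choose d hd using hdiv m hm
    refine ⟨fun g => d (l g), .div m hm (by simpa only [hd] using hl), .inr (.inr fun x g => ?_)⟩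
    rw [hpos, ← sub_pos (b := x), ← nsmul_pos_iff hm (x := d (l g) - x), nsmul_sub, hd, neg_smul,
      natCast_zsmul, neg_add_eq_sub]

end IsAffineMap

namespace IsSemilinear

variable {G : Type*} [AddCommGroup G] [LinearOrder G] {V W : Type*}

theorem empty : IsSemilinear (∅ : Set (V → G)) := by
  simpa using IsSemilinear.pos (V := V) (IsAffineMap.const (0 : G))

theorem univ : IsSemilinear (Set.univ : Set (V → G)) := by
  simpa using (empty (V := V) (G := G)).compl

theorem union {S T : Set (V → G)} (hS : IsSemilinear S) (hT : IsSemilinear T) :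
    IsSemilinear (S ∪ T) := by
  simpa [Set.compl_inter] using (hS.compl.inter hT.compl).compl

theorem const (p : Prop) : IsSemilinear {_g : V → G | p} := by
  by_cases hp : p
  · simpa [hp] using univ (V := V) (G := G)
  · simpa [hp] using empty (V := V) (G := G)

theorem iInter {ι : Type*} [Finite ι] {S : ι → Set (V → G)} (hS : ∀ i, IsSemilinear (S i)) :
    IsSemilinear (⋂ i, S i) := by
  classical
  have := Fintype.ofFinite ι
  have key : ∀ s : Finset ι, IsSemilinear (⋂ i ∈ s, S i) := by
    intro s
    induction s using Finset.induction_on with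
    | empty => simpa using univ (V := V) (G := G)
    | insert a s _ ih => simpa using (hS a).inter ih
  simpa using key Finset.univ

theorem iUnion {ι : Type*} [Finite ι] {S : ι → Set (V → G)} (hS : ∀ i, IsSemilinear (S i)) :
    IsSemilinear (⋃ i, S i) := by
  simpa [Set.compl_iInter] using (iInter fun i => (hS i).compl).compl

theorem preimage {S : Set (V → G)} (hS : IsSemilinear S) {F : (W → G) → V → G}
    (hF : ∀ i, IsAffineMap fun h => F h i) : IsSemilinear (F ⁻¹' S) := by
  induction hS with
  | pos hf => exact .pos (hf.comp hF)
  | compl _ h => exact h.compl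
  | inter _ _ h₁ h₂ => exact h₁.inter h₂

variable [IsOrderedAddMonoid G]

theorem lt {f₁ f₂ : (V → G) → G} (h₁ : IsAffineMap f₁) (h₂ : IsAffineMap f₂) :
    IsSemilinear {g | f₁ g < f₂ g} := by
  simpa only [sub_pos] using IsSemilinear.pos (h₂.sub h₁)

theorem eq {f₁ f₂ : (V → G) → G} (h₁ : IsAffineMap f₁) (h₂ : IsAffineMap f₂) :
    IsSemilinear {g | f₁ g = f₂ g} := by
  convert (lt h₁ h₂).compl.inter (lt h₂ h₁).compl using 1
  ext g
  simp [le_antisymm_iff, and_comm]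

/-- Membership in a semilinear set only depends, in one coordinate, on the position relative to
finitely many affine functions of the other coordinates. -/
theorem exists_thresholds (hdiv : ∀ n : ℕ, n ≠ 0 → ∀ x : G, ∃ y, n • y = x)
    {S : Set (Option V → G)} (hS : IsSemilinear S) :
    ∃ (ι : Type) (_ : Finite ι) (c : ι → (V → G) → G), (∀ i, IsAffineMap (c i)) ∧
      ∀ g x x', (∀ i, (x < c i g ↔ x' < c i g) ∧ (c i g < x ↔ c i g < x')) →
        (optionCons x g ∈ S ↔ optionCons x' g ∈ S) := by
  induction hS with
  | pos hf =>
    obtain ⟨c, hc, h⟩ := hf.pos_iff_lt hdiv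
    refine ⟨Unit, inferInstance, fun _ => c, fun _ => hc, fun g x x' hx => ?_⟩
    have := hx ()
    rcases h with h | h | h <;> simp only [Set.mem_ofPred_eq, h, this]
  | compl _ h =>
    obtain ⟨ι, hι, c, hc, h⟩ := h
    exact ⟨ι, hι, c, hc, fun g x x' hx => not_congr (h g x x' hx)⟩
  | inter _ _ h₁ h₂ =>
    obtain ⟨ι₁, hι₁, c₁, hc₁, h₁⟩ := h₁
    obtain ⟨ι₂, hι₂, c₂, hc₂, h₂⟩ := h₂
    exact ⟨ι₁ ⊕ ι₂, inferInstance, Sum.elim c₁ c₂, by rintro (i | i) <;> simp [hc₁, hc₂],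
      fun g x x' hx => and_congr (h₁ g x x' fun i => hx (.inl i)) (h₂ g x x' fun i => hx (.inr i))⟩

/-- Every point has the same position relative to finitely many `c i` as one of the midpoints
of two of them, one of their translates by `±e`, or `0`. -/
theorem exists_test_point {ι : Type*} [Finite ι] (c : ι → G) {e : G} (he : Subsingleton G ∨ 0 < e)
    (m : ι → ι → G) (hm : ∀ i j, 2 • m i j = c i + c j) (x : G) :
    ∃ x', ((∃ i j, x' = m i j) ∨ (∃ i, x' = c i + e) ∨ (∃ i, x' = c i - e) ∨ x' = 0) ∧
      ∀ i, (x < c i ↔ x' < c i) ∧ (c i < x ↔ c i < x') := by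
  rcases he with hG | he
  · exact ⟨0, by simp, fun i => by simp [Subsingleton.elim x 0]⟩
  have hlt : ∀ i j, c i < c j → c i < m i j ∧ m i j < c j := by
    intro i j hij
    constructor
    · rw [← sub_pos, ← nsmul_pos_iff two_ne_zero, nsmul_sub, hm, two_nsmul]; simpa using hij
    · rw [← sub_pos, ← nsmul_pos_iff two_ne_zero, nsmul_sub, hm, two_nsmul]; simpa using hij
  by_cases hx : ∃ i, c i = x
  · obtain ⟨i, rfl⟩ := hx
    have : m i i = c i := by
      have := hm i i
      rw [← two_nsmul] at this
      exact nsmul_right_injective two_ne_zero this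
    exact ⟨m i i, .inl ⟨i, i, rfl⟩, by simp [this]⟩
  push Not at hx
  have hlow : (∀ i, x < c i) ∨ ∃ i, c i < x ∧ ∀ j, c j < x → c j ≤ c i := by
    by_cases h : ∃ i, c i < x
    · obtain ⟨i, hi, hmax⟩ := (Set.toFinite {i | c i < x}).exists_maximalFor c _ h
      exact .inr ⟨i, hi, fun j hj => (le_total (c j) (c i)).elim id fun h => hmax hj h⟩
    · push Not at h
      exact .inl fun i => (h i).lt_of_ne (hx i).symm
  have hupp : (∀ i, c i < x) ∨ ∃ i, x < c i ∧ ∀ j, x < c j → c i ≤ c j := by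
    by_cases h : ∃ i, x < c i
    · obtain ⟨i, hi, hmin⟩ := (Set.toFinite {i | x < c i}).exists_minimalFor c _ h
      exact .inr ⟨i, hi, fun j hj => (le_total (c i) (c j)).elim id fun h => hmin hj h⟩
    · push Not at h
      exact .inl fun i => (h i).lt_of_ne (hx i)
  -- As `x` is none of the `c i`, it is enough to keep each threshold strictly on its side.
  have position : ∀ x', (∀ j, c j < x → c j < x') → (∀ j, x < c j → x' < c j) →
      ∀ i, (x < c i ↔ x' < c i) ∧ (c i < x ↔ c i < x') := by
    intro x' h₁ h₂ i
    rcases (hx i).lt_or_gt with h | h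
    · simp [h, h₁ i h, h.not_gt, (h₁ i h).not_gt]
    · simp [h, h₂ i h, h.not_gt, (h₂ i h).not_gt]
  rcases hlow with hlow | ⟨i, hi, hmax⟩ <;> rcases hupp with hupp | ⟨j, hj, hmin⟩
  · exact ⟨0, by simp, fun i => absurd (hlow i) (hupp i).not_gt⟩
  · exact ⟨c j - e, by simp, position _ (fun k hk => absurd (hlow k) hk.not_gt) fun k hk =>
      (sub_lt_self _ he).trans_le (hmin k hk)⟩
  · exact ⟨c i + e, by simp, position _ (fun k hk => (hmax k hk).trans_lt (lt_add_of_pos_right _ he))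
      fun k hk => absurd (hupp k) hk.not_gt⟩
  · have := hlt i j (hi.trans hj)
    exact ⟨m i j, .inl ⟨i, j, rfl⟩, position _ (fun k hk => (hmax k hk).trans_lt this.1)
      fun k hk => this.2.trans_le (hmin k hk)⟩

/-- Over a divisible ordered group, projections of semilinear sets are semilinear. -/
theorem projection (hdiv : ∀ n : ℕ, n ≠ 0 → ∀ x : G, ∃ y, n • y = x)
    {S : Set (Option V → G)} (hS : IsSemilinear S) :
    IsSemilinear {g : V → G | ∃ x, optionCons x g ∈ S} := by
  obtain ⟨ι, hι, c, hc, h⟩ := hS.exists_thresholds hdiv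
  obtain ⟨e, he⟩ : ∃ e : G, Subsingleton G ∨ 0 < e := by
    rcases subsingleton_or_nontrivial G with hG | hG
    · exact ⟨0, .inl hG⟩
    · obtain ⟨e, he⟩ := exists_zero_lt (α := G)
      exact ⟨e, .inr he⟩
  choose d hd using hdiv 2 two_ne_zero
  have hsubst : ∀ {a : (V → G) → G}, IsAffineMap a →
      IsSemilinear {g : V → G | optionCons (a g) g ∈ S} := fun {a} ha =>
    hS.preimage (F := fun g => optionCons (a g) g) fun i => by
      cases i with
      | none => exact ha
      | some i => exact .coord i
  have hmid : ∀ i j, IsAffineMap fun g => d (c i g + c j g) := fun i j =>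
    .div 2 two_ne_zero (by simpa only [hd] using (hc i).add (hc j))
  -- Each test point is an affine function of `g`, so the quantifier over `x` becomes a finite union
  -- of affine substitutions, as in Ferrante–Rackoff elimination.
  convert (iUnion fun i => iUnion fun j => hsubst (hmid i j)).union
    ((iUnion fun i => hsubst ((hc i).add (.const e))).union
      ((iUnion fun i => hsubst ((hc i).sub (.const e))).union (hsubst (.const 0)))) using 1
  ext g
  simp only [Set.mem_ofPred_eq, Set.mem_union, Set.mem_iUnion]
  constructor
  · rintro ⟨x, hx⟩
    obtain ⟨x', hx', hpos⟩ := exists_test_point (fun i => c i g) he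
      (fun i j => d (c i g + c j g)) (fun i j => hd _) x
    have hmem := (h g x x' hpos).1 hx
    rcases hx' with ⟨i, j, rfl⟩ | ⟨i, rfl⟩ | ⟨i, rfl⟩ | rfl
    · exact .inl ⟨i, j, hmem⟩
    · exact .inr (.inl ⟨i, hmem⟩)
    · exact .inr (.inr (.inl ⟨i, hmem⟩))
    · exact .inr (.inr (.inr hmem))
  · rintro (⟨i, j, hx⟩ | ⟨i, hx⟩ | ⟨i, hx⟩ | hx) <;> exact ⟨_, hx⟩

end IsSemilinear

/-! ## Uniformly quantifier-free families -/

open Language in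
/-- A family of subsets of a `{C}`-structure is uniformly quantifier-free definable if its members
are defined, with parameters, by finitely many quantifier-free formulas. -/
def IsUniformlyQF {X : Type*} [cLanguage.Structure X] {Y : Type*} (S : Y → Set X) : Prop :=
  ∃ (ι α : Type) (_ : Finite ι) (_ : Finite α) (ψ : ι → cLanguage.Formula (α ⊕ Unit)),
    (∀ i, (ψ i).IsQF) ∧
      ∀ y, ∃ (i : ι) (z : α → X), ∀ x, x ∈ S y ↔ (ψ i).Realize (Sum.elim z fun _ => x)

namespace IsUniformlyQF

open Language

variable {X : Type*} [cLanguage.Structure X] {Y : Type*}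

theorem compl {S : Y → Set X} (hS : IsUniformlyQF S) : IsUniformlyQF fun y => (S y)ᶜ := by
  obtain ⟨ι, α, hι, hα, ψ, hψ, h⟩ := hS
  refine ⟨ι, α, hι, hα, fun i => (ψ i).not, fun i => (hψ i).not, fun y => ?_⟩
  obtain ⟨i, z, hz⟩ := h y
  exact ⟨i, z, fun x => by simp [hz]⟩

theorem inter {S T : Y → Set X} (hS : IsUniformlyQF S) (hT : IsUniformlyQF T) :
    IsUniformlyQF fun y => S y ∩ T y := by
  obtain ⟨ι₁, α₁, hι₁, hα₁, ψ₁, hψ₁, h₁⟩ := hS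
  obtain ⟨ι₂, α₂, hι₂, hα₂, ψ₂, hψ₂, h₂⟩ := hT
  refine ⟨ι₁ × ι₂, α₁ ⊕ α₂, inferInstance, inferInstance,
    fun i => (ψ₁ i.1).relabel (Sum.map Sum.inl id) ⊓ (ψ₂ i.2).relabel (Sum.map Sum.inr id),
    fun i => ((hψ₁ i.1).relabel _).inf ((hψ₂ i.2).relabel _), fun y => ?_⟩
  obtain ⟨i₁, z₁, hz₁⟩ := h₁ y
  obtain ⟨i₂, z₂, hz₂⟩ := h₂ y
  refine ⟨(i₁, i₂), Sum.elim z₁ z₂, fun x => ?_⟩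
  simp only [Set.mem_inter_iff, hz₁, hz₂, Formula.realize_inf, Formula.realize_relabel,
    Sum.elim_comp_map, Sum.elim_comp_inl, Sum.elim_comp_inr, Function.comp_id]

theorem const (p : Y → Prop) : IsUniformlyQF fun y => {_x : X | p y} := by
  -- The truth value of `p y` selects the formula; such case distinctions are the reason for
  -- allowing a finite family of formulas.
  refine ⟨Bool, Empty, inferInstance, inferInstance, fun b => if b then ⊤ else ⊥, ?_, fun y => ?_⟩
  · rintro (_ | _)
    · exact BoundedFormula.isQF_bot
    · exact BoundedFormula.IsQF.top
  · by_cases hp : p y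
    · exact ⟨true, Empty.elim, fun x => by simp [hp]⟩
    · exact ⟨false, Empty.elim, fun x => by simp [hp]⟩

theorem empty : IsUniformlyQF fun _ : Y => (∅ : Set X) := by
  simpa using const (X := X) fun _ : Y => False

theorem union {S T : Y → Set X} (hS : IsUniformlyQF S) (hT : IsUniformlyQF T) :
    IsUniformlyQF fun y => S y ∪ T y := by
  simpa [Set.compl_inter] using (hS.compl.inter hT.compl).compl

theorem iUnion {κ : Type*} [Finite κ] {S : κ → Y → Set X} (hS : ∀ k, IsUniformlyQF (S k)) :
    IsUniformlyQF fun y => ⋃ k, S k y := by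
  classical
  have := Fintype.ofFinite κ
  have key : ∀ s : Finset κ, IsUniformlyQF fun y => ⋃ k ∈ s, S k y := by
    intro s
    induction s using Finset.induction_on with
    | empty => simpa using empty
    | insert a s _ ih => simpa using (hS a).union ih
  simpa using key Finset.univ

theorem iInter {κ : Type*} [Finite κ] {S : κ → Y → Set X} (hS : ∀ k, IsUniformlyQF (S k)) :
    IsUniformlyQF fun y => ⋂ k, S k y := by
  simpa [Set.compl_iUnion] using (iUnion fun k => (hS k).compl).compl

theorem eq (a : Y → X) : IsUniformlyQF fun y => {x | x = a y} := by
  refine ⟨Unit, Unit, inferInstance, inferInstance,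
    fun _ => (Term.var (Sum.inr ())).equal (Term.var (Sum.inl ())),
    fun _ => (BoundedFormula.IsAtomic.equal _ _).isQF, fun y => ⟨(), fun _ => a y, fun x => ?_⟩⟩
  simp

theorem rel_left (a b : Y → X) :
    IsUniformlyQF fun y => {x | Structure.RelMap (L := cLanguage) CRel.c ![x, a y, b y]} := by
  refine ⟨Unit, Bool, inferInstance, inferInstance,
    fun _ => Relations.formula (L := cLanguage) CRel.c
      ![Term.var (Sum.inr ()), Term.var (Sum.inl true), Term.var (Sum.inl false)],
    fun _ => (BoundedFormula.IsAtomic.rel _ _).isQF,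
    fun y => ⟨(), fun i => if i then a y else b y, fun x => ?_⟩⟩
  rw [Formula.realize_rel, Set.mem_ofPred_eq, iff_iff_eq]
  congr 1
  funext i
  fin_cases i <;> rfl

theorem rel_middle (a b : Y → X) :
    IsUniformlyQF fun y => {x | Structure.RelMap (L := cLanguage) CRel.c ![a y, x, b y]} := by
  refine ⟨Unit, Bool, inferInstance, inferInstance,
    fun _ => Relations.formula (L := cLanguage) CRel.c
      ![Term.var (Sum.inl true), Term.var (Sum.inr ()), Term.var (Sum.inl false)],
    fun _ => (BoundedFormula.IsAtomic.rel _ _).isQF,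
    fun y => ⟨(), fun i => if i then a y else b y, fun x => ?_⟩⟩
  rw [Formula.realize_rel, Set.mem_ofPred_eq, iff_iff_eq]
  congr 1
  funext i
  fin_cases i <;> rfl

end IsUniformlyQF

/-! ## Transfer of uniform definability to elementarily equivalent structures -/

section Transfer

open Language

variable {L : FirstOrder.Language.{0, 0}}

/-- A formula mentions finitely many parameters; listing them as a tuple makes it possible to
quantify over them in a sentence. -/
theorem exists_formula_of_definable₁ {N : Type*} [Nonempty N] [L.Structure N] {S : Set N}
    (hS : (Set.univ : Set N).Definable₁ L S) :
    ∃ (n : ℕ) (φ : L.Formula (Fin n ⊕ Unit)) (y : Fin n → N),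
      ∀ x, x ∈ S ↔ φ.Realize (Sum.elim y fun _ => x) := by
  classical
  obtain ⟨φ, hφ⟩ := Set.definable_iff_exists_formula_sum.1 hS
  let e := φ.freeVarFinset.equivFin
  let f : φ.freeVarFinset → Fin φ.freeVarFinset.card ⊕ Unit :=
    fun b => Sum.elim (fun _ => Sum.inl (e b)) (fun _ => Sum.inr ()) b.1
  -- The arbitrary value sits at the index of the set's own variable, which `f` sends to `Sum.inr
  -- ()`, so it is never read.
  let y : Fin φ.freeVarFinset.card → N :=
    fun i => Sum.elim (fun a => a.1) (fun _ => Classical.arbitrary N) (e.symm i).1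
  refine ⟨_, φ.restrictFreeVar f, y, fun x => ?_⟩
  have hx : x ∈ S ↔ φ.Realize (Sum.elim (↑) fun _ => x) := by
    have := Set.ext_iff.1 hφ fun _ => x
    simpa using this
  rw [hx]
  refine (BoundedFormula.realize_restrictFreeVar _ ?_).symm
  rintro ⟨a | a, ha⟩
  · simp [f, y]
  · simp [f]

/-- The sentence which says that the sets defined by `φ` are defined by the formulas `ψ k`. -/
noncomputable def uniformitySentence (ι : cLanguage →ᴸ L) {n : ℕ} (φ : L.Formula (Fin n ⊕ Unit))
    {κ α : Type} [Finite κ] [Finite α] (ψ : κ → cLanguage.Formula (α ⊕ Unit)) : L.Sentence :=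
  let body (k : κ) : L.Formula (((Empty ⊕ Fin n) ⊕ α) ⊕ Unit) :=
    (φ.relabel (Sum.map (Sum.inl ∘ Sum.inr) id)).iff
      ((ι.onFormula (ψ k)).relabel (Sum.map Sum.inr id))
  Formula.iAlls (Fin n) (Formula.iSup fun k => Formula.iExs α (Formula.iAlls Unit (body k)))

theorem realize_uniformitySentence (ι : cLanguage →ᴸ L) {n : ℕ} (φ : L.Formula (Fin n ⊕ Unit))
    {κ α : Type} [Finite κ] [Finite α] (ψ : κ → cLanguage.Formula (α ⊕ Unit))
    (K : Type*) [L.Structure K] :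
    letI := ι.reduct K
    K ⊨ uniformitySentence ι φ ψ ↔ ∀ y : Fin n → K, ∃ (k : κ) (z : α → K), ∀ x,
      φ.Realize (Sum.elim y fun _ => x) ↔ (ψ k).Realize (Sum.elim z fun _ => x) := by
  let _ := ι.reduct K
  simp only [uniformitySentence, Sentence.Realize, Formula.realize_iAlls, Formula.realize_iSup,
    Formula.realize_iExs, Formula.realize_iff, Formula.realize_relabel, LHom.realize_onFormula,
    Sum.elim_comp_map, Function.comp_id]
  refine forall_congr' fun y => exists_congr fun k => exists_congr fun z => ?_
  constructor
  · intro h x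
    exact h fun _ => x
  · intro h x
    exact h (x ())

/-- If all formulas define uniformly quantifier-free families in `M`, then all definable subsets
of elementarily equivalent structures are quantifier-free definable. -/
theorem isCMinimal_of_isUniformlyQF (ι : cLanguage →ᴸ L) (M : Type u) [L.Structure M] [Nonempty M]
    (hC : IsCRelation fun x y z : M => Structure.RelMap (ι.onRelation CRel.c) ![x, y, z])
    (hM : letI := ι.reduct M
      ∀ (n : ℕ) (φ : L.Formula (Fin n ⊕ Unit)),
        IsUniformlyQF fun y : Fin n → M => {x | φ.Realize (Sum.elim y fun _ => x)}) :
    IsCMinimal.{u, w} ι M := by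
  refine ⟨hC, fun N _ hMN S hS => ?_⟩
  have : Nonempty N := hMN.nonempty_iff.1 inferInstance
  obtain ⟨n, φ, y, hφ⟩ := exists_formula_of_definable₁ hS
  obtain ⟨κ, α, _, _, ψ, hψ, h⟩ := hM n φ
  have hN := (hMN.realize_sentence _).1 ((realize_uniformitySentence ι φ ψ M).2 h)
  obtain ⟨k, z, hz⟩ := (realize_uniformitySentence ι φ ψ N).1 hN y
  let _ := ι.reduct N
  refine ⟨(ψ k).relabel (Sum.map z id), (hψ k).relabel _, fun x => ?_⟩
  rw [hφ, hz, Formula.realize_relabel, Sum.elim_comp_map]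
  rfl

end Transfer

/-! ## The C-relation of a compatible product -/

section Product

variable {G : Type*} [AddCommGroup G] [LinearOrder G] [IsOrderedAddMonoid G]
  {H : Type*} [AddCommGroup H] {Γ : Type*} [LinearOrder Γ] {r : H → H → Prop}
  {val : GroupValuation H Γ}

/-- Outside `G × {0}`, `x ∼ -x`, so a singleton class would force `2 • x = 0`, which the condition
on the order excludes. On `G × {0}` the quasi-order is antisymmetric and there is no 2-torsion. -/
theorem isOType_compatibleProduct_iff (hr : ∀ a b, r a b ↔ val.qo a b) (x : G × H) :
    IsOType (compatibleProduct r) x ↔ x.2 = 0 := by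
  constructor
  · rintro ⟨hx, ho⟩
    by_contra h0
    have hneg : -x ∈ {h | compatibleProduct r h x ∧ compatibleProduct r x h} := by
      simp [compatibleProduct, h0, hr, GroupValuation.qo, val.map_neg]
    rw [hx, Set.mem_singleton_iff, neg_eq_iff_add_eq_zero, ← two_nsmul] at hneg
    exact ho (addOrderOf_eq_prime hneg fun h => h0 (by simp [h]))
  · intro h0
    constructor
    · ext y
      simp only [compatibleProduct, h0, Set.mem_ofPred_eq, Set.mem_singleton_iff, hr,
        GroupValuation.qo, (val.eq_top_iff 0).2 rfl, top_le_iff, val.eq_top_iff]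
      constructor
      · rintro ⟨⟨h₂, _, h₁⟩ | h, ⟨_, _, h₃⟩ | h'⟩
        · exact Prod.ext (le_antisymm h₁ h₃) (by simp [h₂, h0])
        · exact absurd h₂ h'.1
        · exact absurd rfl h.1
        · exact absurd rfl h.1
      · rintro rfl
        simp [h0]
    · intro ho
      have h2 : 2 • x = 0 := by rw [← ho]; exact addOrderOf_nsmul_eq_zero x
      have h1 : x.1 = 0 := (nsmul_eq_zero_iff_right two_ne_zero).1 (congrArg Prod.fst h2)
      have hx : x = 0 := Prod.ext h1 h0
      simp [hx] at ho

/-- This is the working form of `C`: the valuation compares `H`-components, and inside one fibre the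
order of `G` decides. -/
theorem inducedC_compatibleProduct_iff (hr : ∀ a b, r a b ↔ val.qo a b) (x y z : G × H) :
    inducedC (compatibleProduct r) x y z ↔ (x ≠ y ∧ y = z) ∨
      val.toFun (x.2 - z.2) < val.toFun (y.2 - z.2) ∨
      (x.2 = z.2 ∧ y.2 = z.2 ∧ y.1 < x.1 ∧ z.1 < x.1) := by
  simp only [inducedC, isOType_compatibleProduct_iff hr, Prod.snd_sub, sub_eq_zero]
  have hv : ∀ a b : G × H, b.2 ≠ 0 →
      (StrictQO (compatibleProduct r) a b ↔ val.toFun b.2 < val.toFun a.2) := by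
    intro a b hb
    have hb' : val.toFun b.2 < ⊤ := lt_top_iff_ne_top.2 fun h => hb ((val.eq_top_iff _).1 h)
    by_cases ha : a.2 = 0
    · simp [StrictQO, compatibleProduct, ha, hb, hb', hr, GroupValuation.qo,
        (val.eq_top_iff 0).2 rfl]
    · simp only [StrictQO, compatibleProduct, ha, hb, hr, GroupValuation.qo]
      simp only [false_and, and_false, ne_eq, false_or]
      rw [lt_iff_le_not_ge]
      tauto
  have ho : ∀ b : G × H, b.2 = 0 → (StrictQO (compatibleProduct r) 0 b ↔ 0 < b.1) := by
    intro b hb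
    simp only [StrictQO, compatibleProduct, hb, Prod.fst_zero, Prod.snd_zero, true_and, ne_eq,
      not_true_eq_false, false_and, or_false]
    rw [lt_iff_le_not_ge]
    tauto
  refine or_congr Iff.rfl (or_congr ?_ ?_)
  · constructor
    · rintro ⟨hne, h⟩
      exact (hv _ _ (by simpa [sub_eq_zero] using hne)).1 h
    · intro h
      have hne : x.2 ≠ z.2 := by
        rintro h'
        rw [h', sub_self, (val.eq_top_iff 0).2 rfl] at h
        exact not_top_lt h
      exact ⟨hne, (hv _ _ (by simpa [sub_eq_zero] using hne)).2 h⟩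
  · constructor
    · rintro ⟨h₁, h₂, h₃, h₄⟩
      rw [ho _ (by simp [h₁, h₂])] at h₃
      rw [ho _ (by simp [h₂])] at h₄
      exact ⟨h₂, h₁, by simpa using h₃, by simpa using h₄⟩
    · rintro ⟨h₂, h₁, h₃, h₄⟩
      rw [ho _ (by simp [h₁, h₂]), ho _ (by simp [h₂])]
      exact ⟨h₁, h₂, by simpa using h₃, by simpa using h₄⟩

theorem GroupValuation.map_sub_rev (val : GroupValuation H Γ) (a b : H) :
    val.toFun (a - b) = val.toFun (b - a) := by
  rw [← neg_sub, val.map_neg]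

theorem GroupValuation.min_le_sub (val : GroupValuation H Γ) (a b c : H) :
    min (val.toFun (a - b)) (val.toFun (b - c)) ≤ val.toFun (a - c) := by
  simpa using val.min_le_add (a - b) (b - c)

theorem isCompatibleCRelation_inducedC (hr : ∀ a b, r a b ↔ val.qo a b) :
    IsCompatibleCRelation (inducedC (compatibleProduct (G := G) r)) where
  c1 x y z := by
    simp only [inducedC_compatibleProduct_iff hr]
    rintro (⟨h₁, rfl⟩ | h | ⟨h₁, h₂, h₃, h₄⟩)
    · exact .inl ⟨h₁, rfl⟩
    · right; left
      rw [val.map_sub_rev z.2]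
      by_contra! hc
      have := val.min_le_sub x.2 y.2 z.2
      rw [min_eq_right hc] at this
      exact this.not_gt h
    · exact .inr (.inr ⟨h₁.trans h₂.symm, h₂.symm, h₄, h₃⟩)
  c2 x y z := by
    simp only [inducedC_compatibleProduct_iff hr]
    rintro (⟨h₁, rfl⟩ | h | ⟨h₁, h₂, h₃, h₄⟩) (⟨h₁', h₂'⟩ | h' | ⟨h₁', h₂', h₃', h₄'⟩)
    · exact h₁ h₂'
    · rw [sub_self, (val.eq_top_iff 0).2 rfl] at h'
      exact not_top_lt h'
    · exact lt_irrefl _ h₄'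
    · rw [h₂', sub_self, (val.eq_top_iff 0).2 rfl] at h
      exact not_top_lt h
    · exact lt_asymm h h'
    · rw [h₁', h₂'] at h
      exact lt_irrefl _ h
    · exact h₄.ne (congrArg Prod.fst h₂').symm
    · rw [h₁, h₂] at h'
      exact lt_irrefl _ h'
    · exact lt_asymm h₃ h₃'
  c3 x y z a := by
    simp only [inducedC_compatibleProduct_iff hr]
    rintro (⟨h₁, rfl⟩ | h | ⟨h₁, h₂, h₃, h₄⟩)
    · by_cases hy : a = y
      · subst hy
        exact .inr (.inl ⟨h₁, rfl⟩)
      · exact .inl (.inl ⟨hy, rfl⟩)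
    · rcases lt_or_ge (val.toFun (a.2 - z.2)) (val.toFun (y.2 - z.2)) with h' | h'
      · exact .inl (.inr (.inl h'))
      · exact .inr (.inr (.inl (h.trans_le h')))
    · by_cases ha : a.2 = z.2
      · rcases lt_or_ge a.1 x.1 with hax | hax
        · exact .inr (.inr (.inr ⟨h₁, ha, hax, h₄⟩))
        · exact .inl (.inr (.inr ⟨ha, h₂, h₃.trans_le hax, h₄.trans_le hax⟩))
      -- Here `y` and `z` share a fibre that misses `a`, so `y.2 - z.2` has value `⊤` and `a.2 -
      -- z.2` does not.
      · left; right; left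
        rw [h₂, sub_self, (val.eq_top_iff 0).2 rfl, lt_top_iff_ne_top, ne_eq, val.eq_top_iff,
          sub_eq_zero]
        exact ha
  c4 x y h := .inl ⟨h, rfl⟩
  translate x y z a b := by
    simp only [inducedC_compatibleProduct_iff hr, Prod.fst_add, Prod.snd_add,
      add_sub_add_right_eq_sub, add_sub_add_left_eq_sub, ne_eq, add_left_inj, add_right_inj,
      add_lt_add_iff_right, add_lt_add_iff_left]
    exact id

end Product

/-! ## Definable sets in a compatible product -/

section Definable

open Language

theorem realize_term_prod {G H : Type*} [AddCommGroup G] [AddCommGroup H]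
    (C : G × H → G × H → G × H → Prop) {V : Type*}
    (s : cGroupLanguage.Term V) :
    letI := cGroupStructure C
    ∃ (f : (V → G) → G) (k : (V → H) → H), IsAffineMap f ∧
      ∀ (g : V → G) (τ : V → H), s.realize (fun i => (g i, τ i)) = (f g, k τ) := by
  let _ := cGroupStructure C
  induction s with
  | var i => exact ⟨fun g => g i, fun τ => τ i, .coord i, fun _ _ => rfl⟩
  | func F ts ih =>
    choose f k hf h using ih
    cases F with
    | zero => exact ⟨fun _ => 0, fun _ => 0, .const 0, fun _ _ => rfl⟩
    | neg =>
      refine ⟨fun g => -f 0 g, fun τ => -k 0 τ, (hf 0).neg, fun g τ => ?_⟩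
      exact congrArg Neg.neg (h 0 g τ)
    | add =>
      refine ⟨fun g => f 0 g + f 1 g, fun τ => k 0 τ + k 1 τ, (hf 0).add (hf 1), fun g τ => ?_⟩
      exact congrArg₂ (· + ·) (h 0 g τ) (h 1 g τ)

variable {G : Type*} [AddCommGroup G] [LinearOrder G] [IsOrderedAddMonoid G]
  {H : Type*} [AddCommGroup H] {Γ : Type*} [LinearOrder Γ] {r : H → H → Prop}
  {val : GroupValuation H Γ}

theorem isSemilinear_inducedC (hr : ∀ a b, r a b ↔ val.qo a b) {V : Type*}
    {f₁ f₂ f₃ : (V → G) → G} (h₁ : IsAffineMap f₁) (h₂ : IsAffineMap f₂) (h₃ : IsAffineMap f₃)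
    (a b c : H) :
    IsSemilinear {g | inducedC (compatibleProduct r) (f₁ g, a) (f₂ g, b) (f₃ g, c)} := by
  simp only [inducedC_compatibleProduct_iff hr, ne_eq, Prod.mk.injEq]
  exact (((IsSemilinear.eq h₁ h₂).inter (.const _)).compl.inter
    ((IsSemilinear.eq h₂ h₃).inter (.const _))).union
      ((IsSemilinear.const _).union ((IsSemilinear.const _).inter ((IsSemilinear.const _).inter
        ((IsSemilinear.lt h₂ h₁).inter (IsSemilinear.lt h₃ h₁)))))

/-- Once the components in `H` of the variables are fixed, the formulas of the language of
C-groups define semilinear sets. -/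
theorem isSemilinear_setOf_realize [Finite H] (hr : ∀ a b, r a b ↔ val.qo a b)
    (hdiv : ∀ n : ℕ, n ≠ 0 → ∀ x : G, ∃ y, n • y = x) {V : Type*} {m : ℕ}
    (φ : cGroupLanguage.BoundedFormula V m) (τ : V ⊕ Fin m → H) :
    letI := cGroupStructure (inducedC (compatibleProduct (G := G) r))
    IsSemilinear {g : V ⊕ Fin m → G | φ.Realize (fun i => (g (.inl i), τ (.inl i)))
      fun i => (g (.inr i), τ (.inr i))} := by
  let _ := cGroupStructure (inducedC (compatibleProduct (G := G) r))
  have hterm : ∀ {m : ℕ} (s : cGroupLanguage.Term (V ⊕ Fin m)), ∃ (f : (V ⊕ Fin m → G) → G)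
      (k : (V ⊕ Fin m → H) → H), IsAffineMap f ∧ ∀ (g : V ⊕ Fin m → G) (τ : V ⊕ Fin m → H),
        s.realize (Sum.elim (fun i => (g (.inl i), τ (.inl i)))
          fun i => (g (.inr i), τ (.inr i))) = (f g, k τ) := by
    intro m s
    obtain ⟨f, k, hf, h⟩ := realize_term_prod (inducedC (compatibleProduct (G := G) r)) s
    refine ⟨f, k, hf, fun g τ => ?_⟩
    rw [← h]
    congr 1
    ext (i | i) <;> rfl
  induction φ with
  | falsum => exact .empty
  | equal s₁ s₂ =>
    obtain ⟨f₁, k₁, hf₁, h₁⟩ := hterm s₁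
    obtain ⟨f₂, k₂, hf₂, h₂⟩ := hterm s₂
    simp only [BoundedFormula.Realize, h₁, h₂, Prod.mk.injEq]
    exact (IsSemilinear.eq hf₁ hf₂).inter (.const _)
  | rel R ts =>
    cases R
    choose f k hf h using fun i => hterm (ts i)
    simp only [BoundedFormula.Realize, h]
    exact isSemilinear_inducedC hr (hf 0) (hf 1) (hf 2) _ _ _
  | imp _ _ ih₁ ih₂ =>
    convert (ih₁ τ).compl.union (ih₂ τ) using 1
    ext g
    exact imp_iff_not_or
  | @all m φ ih =>
    let F (h : Option (V ⊕ Fin m) → G) : V ⊕ Fin (m + 1) → G :=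
      Sum.elim (fun i => h (some (.inl i)))
        (Fin.snoc (α := fun _ => G) (fun i => h (some (.inr i))) (h none))
    let τ' (a : H) : V ⊕ Fin (m + 1) → H :=
      Sum.elim (fun i => τ (.inl i)) (Fin.snoc (α := fun _ => H) (fun i => τ (.inr i)) a)
    have hF : ∀ i, IsAffineMap fun h => F h i := by
      rintro (i | i)
      · exact .coord _
      · cases i using Fin.lastCases with
        | last => simpa [F] using IsAffineMap.coord (G := G) none
        | cast i => simpa [F] using IsAffineMap.coord (G := G) (some (Sum.inr i))
    -- The universal quantifier splits into a finite intersection over the `H`-component and, over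
    -- `G`, the complement of a projection of a complement.
    convert IsSemilinear.iInter fun a : H =>
      (((ih (τ' a)).preimage hF).compl.projection hdiv).compl using 1
    ext g
    simp only [Set.mem_ofPred_eq, BoundedFormula.realize_all, Prod.forall, Set.mem_iInter,
      Set.mem_compl_iff, Set.mem_preimage, not_exists, not_not]
    rw [forall_comm]
    refine forall_congr' fun a => forall_congr' fun x => ?_
    rw [iff_iff_eq]
    congr 1
    funext i
    cases i using Fin.lastCases with
    | last => simp [F, τ', optionCons]
    | cast i => simp [F, τ', optionCons]

/-- The fibre over `a` is the intersection, over the finitely many `b ≠ a`, of the conditions `C((0,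
b), x, (0, a))`: a point `x` outside it violates the one with `b = x.2`. -/
theorem isUniformlyQF_fiber [Finite H] (hr : ∀ a b, r a b ↔ val.qo a b) (Y : Type*) (a : H) :
    letI := cGroupStructure (inducedC (compatibleProduct (G := G) r))
    letI := cInclusion.reduct (G × H)
    IsUniformlyQF fun _ : Y => {x : G × H | x.2 = a} := by
  let _ := cGroupStructure (inducedC (compatibleProduct (G := G) r))
  let _ := cInclusion.reduct (G × H)
  convert IsUniformlyQF.iInter fun b : {b : H // b ≠ a} =>
    IsUniformlyQF.rel_middle (fun _ : Y => ((0 : G), (b : H))) (fun _ : Y => ((0 : G), a)) using 2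
  ext x
  simp only [Set.mem_ofPred_eq, Set.mem_iInter]
  have hC : ∀ b : {b : H // b ≠ a}, Structure.RelMap (L := cLanguage) CRel.c
      ![((0 : G), (b : H)), x, ((0 : G), a)] ↔
        inducedC (compatibleProduct r) ((0 : G), (b : H)) x (0, a) := fun _ => Iff.rfl
  simp only [hC, inducedC_compatibleProduct_iff hr]
  constructor
  · rintro hx ⟨b, hb⟩
    right; left
    rw [hx, sub_self, (val.eq_top_iff 0).2 rfl, lt_top_iff_ne_top, ne_eq, val.eq_top_iff,
      sub_eq_zero]
    exact hb
  · intro h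
    by_contra hx
    rcases h ⟨x.2, hx⟩ with ⟨_, h⟩ | h | h
    · exact hx (congrArg Prod.snd h)
    · exact lt_irrefl _ h
    · exact hx h.1

theorem isUniformlyQF_ray [Finite H] (hr : ∀ a b, r a b ↔ val.qo a b) {Y : Type*} (a : H)
    (c : Y → G) :
    letI := cGroupStructure (inducedC (compatibleProduct (G := G) r))
    letI := cInclusion.reduct (G × H)
    IsUniformlyQF fun y : Y => {x : G × H | x.2 = a ∧ c y < x.1} := by
  let _ := cGroupStructure (inducedC (compatibleProduct (G := G) r))
  let _ := cInclusion.reduct (G × H)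
  rcases subsingleton_or_nontrivial G with hG | hG
  · convert IsUniformlyQF.empty (X := G × H) (Y := Y) using 2 with y
    ext x
    simp [Subsingleton.elim (c y) x.1]
  obtain ⟨e, he⟩ := exists_zero_lt (α := G)
  convert (isUniformlyQF_fiber hr Y a).inter
    (IsUniformlyQF.rel_left (fun y : Y => (c y, a)) (fun y => (c y - e, a))) using 2 with y
  ext ⟨x, b⟩
  refine and_congr_right fun hb => ?_
  obtain rfl : b = a := hb
  change c y < x ↔ inducedC (compatibleProduct r) (x, b) (c y, b) (c y - e, b)
  rw [inducedC_compatibleProduct_iff hr]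
  simp only [lt_irrefl, Prod.mk.injEq, and_true, true_and, false_or]
  constructor
  · intro h
    exact .inr ⟨h, (sub_lt_self _ he).trans h⟩
  · rintro (⟨_, h⟩ | h)
    · exact absurd h (sub_lt_self _ he).ne'
    · exact h.1

/-- In the variable `x`, a half-space is a ray or a condition on parameters alone. Lower rays and
complements are taken relative to the fibre. -/
theorem IsSemilinear.isUniformlyQF [Finite H] (hr : ∀ a b, r a b ↔ val.qo a b)
    (hdiv : ∀ n : ℕ, n ≠ 0 → ∀ x : G, ∃ y, n • y = x) {Y V : Type*} (a : H) (g : Y → V → G)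
    {S : Set (Option V → G)} (hS : IsSemilinear S) :
    letI := cGroupStructure (inducedC (compatibleProduct (G := G) r))
    letI := cInclusion.reduct (G × H)
    IsUniformlyQF fun y : Y => {x : G × H | x.2 = a ∧ optionCons x.1 (g y) ∈ S} := by
  let _ := cGroupStructure (inducedC (compatibleProduct (G := G) r))
  let _ := cInclusion.reduct (G × H)
  have hfib := isUniformlyQF_fiber (G := G) hr Y a
  induction hS with
  | pos hf =>
    obtain ⟨c, -, h | h | h⟩ := hf.pos_iff_lt hdiv
    · simp only [Set.mem_ofPred_eq, h]
      exact hfib.inter (.const _)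
    · simp only [Set.mem_ofPred_eq, h]
      exact isUniformlyQF_ray hr a _
    · simp only [Set.mem_ofPred_eq, h]
      convert hfib.inter ((isUniformlyQF_ray hr a fun y => c (g y)).union
        (IsUniformlyQF.eq fun y => (c (g y), a))).compl using 2 with y
      ext ⟨x, b⟩
      refine and_congr_right fun hb => ?_
      obtain rfl : b = a := hb
      simp only [Set.mem_compl_iff, Set.mem_union, Set.mem_ofPred_eq, true_and, Prod.mk.injEq,
        and_true, not_or, not_lt]
      exact lt_iff_le_and_ne
  | compl _ ih =>
    convert hfib.inter ih.compl using 2 with y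
    ext x
    simp only [Set.mem_ofPred_eq, Set.mem_inter_iff, Set.mem_compl_iff]
    tauto
  | inter _ _ ih₁ ih₂ =>
    convert ih₁.inter ih₂ using 2 with y
    ext x
    simp only [Set.mem_ofPred_eq, Set.mem_inter_iff]
    tauto

theorem isUniformlyQF_setOf_realize [Finite H] (hr : ∀ a b, r a b ↔ val.qo a b)
    (hdiv : ∀ n : ℕ, n ≠ 0 → ∀ x : G, ∃ y, n • y = x) {n : ℕ}
    (φ : cGroupLanguage.Formula (Fin n ⊕ Unit)) :
    letI := cGroupStructure (inducedC (compatibleProduct (G := G) r))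
    letI := cInclusion.reduct (G × H)
    IsUniformlyQF fun y : Fin n → G × H => {x | φ.Realize (Sum.elim y fun _ => x)} := by
  let _ := cGroupStructure (inducedC (compatibleProduct (G := G) r))
  let _ := cInclusion.reduct (G × H)
  let F (h : Option (Fin n) → G) : (Fin n ⊕ Unit) ⊕ Fin 0 → G :=
    Sum.elim (Sum.elim (fun i => h (some i)) fun _ => h none) Fin.elim0
  have hF : ∀ i, IsAffineMap fun h => F h i := by
    rintro ((i | i) | i)
    · exact .coord _
    · exact .coord _
    · exact i.elim0
  let τ' (p : (Fin n → H) × H) : (Fin n ⊕ Unit) ⊕ Fin 0 → H :=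
    Sum.elim (Sum.elim p.1 fun _ => p.2) Fin.elim0
  have hS := fun p => (isSemilinear_setOf_realize (G := G) hr hdiv φ (τ' p)).preimage hF
  -- The pair `p` guesses the `H`-components of the parameters and of `x`; there are finitely many
  -- guesses, and the one on the parameters is a condition on `y` alone.
  convert IsUniformlyQF.iUnion fun p : (Fin n → H) × H =>
    (IsUniformlyQF.const fun y : Fin n → G × H => (fun i => (y i).2) = p.1).inter
      ((hS p).isUniformlyQF hr hdiv p.2 fun y i => (y i).1) using 2 with y
  ext x
  simp only [Set.mem_ofPred_eq, Set.mem_iUnion, Set.mem_inter_iff, Set.mem_preimage]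
  have key : ∀ p : (Fin n → H) × H, (fun i => (y i).2) = p.1 → x.2 = p.2 →
      (φ.Realize (Sum.elim y fun _ => x) ↔ BoundedFormula.Realize φ
        (fun i => (F (optionCons x.1 fun i => (y i).1) (.inl i), τ' p (.inl i)))
        fun i => (F (optionCons x.1 fun i => (y i).1) (.inr i), τ' p (.inr i))) := by
    rintro ⟨_, _⟩ rfl rfl
    rw [Formula.Realize, iff_iff_eq]
    congr 1
    · ext (i | i) <;> rfl
    · exact Subsingleton.elim _ _
  constructor
  · intro h
    exact ⟨(fun i => (y i).2, x.2), rfl, rfl, (key _ rfl rfl).1 h⟩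
  · rintro ⟨p, h₁, h₂, h⟩
    exact (key p h₁ h₂).2 h

end Definable

/-- The compatible product of a divisible ordered group with a finite valued group is C-minimal. -/
theorem isCMinimalGroup_of_divisible {G : Type u} [AddCommGroup G] [LinearOrder G]
    [IsOrderedAddMonoid G] (hdiv : ∀ n : ℕ, n ≠ 0 → ∀ x : G, ∃ y, n • y = x)
    {H : Type v} [AddCommGroup H] [Finite H] {r : H → H → Prop} (hr : IsValuational.{v, t} r) :
    IsCMinimalGroup.{max u v, w} (inducedC (compatibleProduct (G := G) r)) := by
  obtain ⟨Γ, _, val, hr⟩ := hr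
  refine ⟨isCompatibleCRelation_inducedC hr, ?_⟩
  let _ := cGroupStructure (inducedC (compatibleProduct (G := G) r))
  exact isCMinimal_of_isUniformlyQF cInclusion (G × H)
    (isCompatibleCRelation_inducedC hr).toIsCRelation
    fun _ φ => isUniformlyQF_setOf_realize hr hdiv φ

/-! ## O-minimal ordered groups are divisible -/

section OMinimal

open Language

theorem IsIntervalSet.bddAbove_or_Ioi_subset {G : Type*} [LinearOrder G] [Nonempty G] {I : Set G}
    (hI : IsIntervalSet I) : BddAbove I ∨ ∃ a, Set.Ioi a ⊆ I := by
  rcases hI with rfl | ⟨a, rfl | rfl | rfl | rfl⟩ | ⟨a, b, rfl | rfl | rfl | rfl⟩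
  · exact .inr ⟨Classical.arbitrary G, Set.subset_univ _⟩
  · exact .inl bddAbove_Iio
  · exact .inl bddAbove_Iic
  · exact .inr ⟨a, subset_rfl⟩
  · exact .inr ⟨a, Set.Ioi_subset_Ici_self⟩
  · exact .inl bddAbove_Ioo
  · exact .inl bddAbove_Ioc
  · exact .inl bddAbove_Ico
  · exact .inl bddAbove_Icc

theorem exists_term_realize_eq_nsmul {G : Type*} [AddCommGroup G] (r : G → G → Prop) {V : Type*}
    (i : V) (n : ℕ) :
    letI := qoGroupStructure r
    ∃ s : qoGroupLanguage.Term V, ∀ v : V → G, s.realize v = n • v i := by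
  let _ := qoGroupStructure r
  induction n with
  | zero => exact ⟨Term.func GroupFunc.zero Fin.elim0, fun v => (zero_nsmul _).symm⟩
  | succ n ih =>
    obtain ⟨s, hs⟩ := ih
    refine ⟨Term.func GroupFunc.add ![s, Term.var i], fun v => ?_⟩
    rw [succ_nsmul, ← hs]
    rfl

theorem definable₁_range_nsmul {G : Type*} [AddCommGroup G] (r : G → G → Prop) (n : ℕ) :
    letI := qoGroupStructure r
    (Set.univ : Set G).Definable₁ qoGroupLanguage {x : G | ∃ y, n • y = x} := by
  let _ := qoGroupStructure r
  obtain ⟨s, hs⟩ := exists_term_realize_eq_nsmul r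
    (Sum.inr 0 : ((Set.univ : Set G) ⊕ Fin 1) ⊕ Fin 1) n
  refine Set.definable_iff_exists_formula_sum.2
    ⟨(s.bdEqual (Term.var (Sum.inl (Sum.inr 0)))).ex, ?_⟩
  ext x
  simp only [Set.mem_ofPred_eq, Formula.Realize, BoundedFormula.realize_ex,
    BoundedFormula.realize_bdEqual, hs]
  rfl

/-- The definable subgroup `nG` is unbounded above, so one of its finitely many intervals contains a
ray. Every element of `G` is a difference of two elements of that ray. -/
theorem IsOMinimalGroup.divisible {G : Type*} [AddCommGroup G] [LinearOrder G]
    [IsOrderedAddMonoid G] (hG : IsOMinimalGroup G) (n : ℕ) (hn : n ≠ 0) (x : G) :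
    ∃ y, n • y = x := by
  rcases subsingleton_or_nontrivial G with _ | _
  · exact ⟨x, Subsingleton.elim _ _⟩
  obtain ⟨e, he⟩ := exists_zero_lt (α := G)
  obtain ⟨F, hF, hint, -, hS⟩ := hG _ (definable₁_range_nsmul _ n)
  have hunb : ¬ BddAbove {x : G | ∃ y, n • y = x} := by
    rintro ⟨b, hb⟩
    have hpos : 0 < |b| + e := add_pos_of_nonneg_of_pos (abs_nonneg b) he
    have h₁ : n • (|b| + e) ≤ b := hb ⟨_, rfl⟩
    have h₂ : |b| + e ≤ n • (|b| + e) := le_self_nsmul hpos.le hn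
    exact (((le_abs_self b).trans_lt (lt_add_of_pos_right _ he)).trans_le h₂).not_ge h₁
  rw [hS, Set.sUnion_eq_biUnion, hF.bddAbove_biUnion] at hunb
  push Not at hunb
  obtain ⟨I, hI, hIb⟩ := hunb
  obtain ⟨a, ha⟩ := (hint I hI).bddAbove_or_Ioi_subset.resolve_left hIb
  have hmem : ∀ z, a < z → ∃ y, n • y = z := fun z hz => by
    have : z ∈ ⋃₀ F := ⟨I, hI, ha hz⟩
    rwa [← hS] at this
  -- The point is chosen so that both it and its translate by `x` lie beyond `a`.
  obtain ⟨p, hp⟩ := hmem (|a| + |x| + e) (lt_add_of_le_of_pos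
    ((le_abs_self a).trans (le_add_of_nonneg_right (abs_nonneg x))) he)
  obtain ⟨q, hq⟩ := hmem (|a| + |x| + e + x) (by
    rw [add_assoc, add_assoc, ← add_assoc |x|, add_right_comm]
    refine lt_of_le_of_lt (le_abs_self a) (lt_add_of_pos_right _ ?_)
    exact add_pos_of_nonneg_of_pos (neg_le_iff_add_nonneg.1 (neg_le_abs x)) he)
  exact ⟨q - p, by rw [nsmul_sub, hp, hq, add_sub_cancel_left]⟩

end OMinimal

theorem mainTheorem5 :
    (∀ (G : Type u) [AddCommGroup G] [LinearOrder G] [IsOrderedAddMonoid G]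
      (H : Type v) [AddCommGroup H] [Finite H] (r : H → H → Prop),
      IsOMinimalGroup G → IsValuational.{v, t} r →
      IsCMinimalGroup.{max u v, w} (inducedC (compatibleProduct (G := G) r))) ∧
    (∀ (p k : ℕ) [Fact p.Prime],
      let q : ℚ × ZMod (p ^ k) → ℚ × ZMod (p ^ k) → Prop :=
        compatibleProduct (zmodPadicValuation p k).qo
      IsCMinimalGroup.{0, w} (inducedC q) ∧
      (1 ≤ k →
        ¬ (∀ a b, q a b → q b a → a = b) ∧ ¬ IsValuational.{0, t} q ∧
        ¬ IsInducedByGroupOrder (inducedC q) ∧ ¬ IsInducedByValuation.{0, t} (inducedC q))) := by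
  refine ⟨fun G _ _ _ H _ _ r hG hr => isCMinimalGroup_of_divisible hG.divisible hr,
    fun p k _ => ?_⟩
  have hp : p.Prime := Fact.out
  have : NeZero (p ^ k) := ⟨pow_ne_zero _ hp.ne_zero⟩
  have hval : ∀ a b, (zmodPadicValuation p k).qo a b ↔ (zmodPadicValuation p k).qo a b :=
    fun _ _ => Iff.rfl
  intro q
  have hdiv : ∀ n : ℕ, n ≠ 0 → ∀ x : ℚ, ∃ y, n • y = x :=
    fun n hn x => ⟨x / n, by rw [nsmul_eq_mul]; field_simp⟩
  have hr : IsValuational.{0, 0} (zmodPadicValuation p k).qo := ⟨ℕ, inferInstance, _, hval⟩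
  refine ⟨isCMinimalGroup_of_divisible hdiv hr, fun hk => ?_⟩
  have : Fact (1 < p ^ k) := ⟨Nat.one_lt_pow (by lia) hp.one_lt⟩
  refine ⟨fun h => ?_, ?_, ?_, ?_⟩
  · have := h (0, 1) (1, 1) (.inr ⟨one_ne_zero, le_rfl⟩) (.inr ⟨one_ne_zero, le_rfl⟩)
    exact zero_ne_one (congrArg Prod.fst this)
  · rintro ⟨Γ, _, v, hv⟩
    -- A valuation does not distinguish an element from its negative, but `1 ≤ -1` fails in `ℚ`.
    have h : q (1, 0) (-(1, 0)) := by
      rw [hv, GroupValuation.qo, v.map_neg]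
    simp only [q, compatibleProduct] at h
    norm_num at h
  · rintro ⟨_, _, -⟩
    -- Ordered groups are torsion-free, and `(0, 1)` is a nonzero torsion element.
    have h : p ^ k • ((0, 1) : ℚ × ZMod (p ^ k)) = 0 := by
      ext
      · simp
      · simp
    have h0 := (nsmul_eq_zero_iff_right (pow_ne_zero k hp.ne_zero)).1 h
    exact one_ne_zero (congrArg Prod.snd h0)
  · rintro ⟨Γ, _, v, hv⟩
    -- `C` holds because `0 < 2` and `1 < 2`, yet the differences `x - z` and `y - z` are opposite,
    -- so their values agree.
    have h := (hv (2, 0) (0, 0) (1, 0)).1 ((inducedC_compatibleProduct_iff hval _ _ _).2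
      (.inr (.inr (by norm_num))))
    rw [v.map_sub_rev (0, 0)] at h
    norm_num at h
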